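/- Let $n,r\ge 1$ and $k\ge 2$ be integers, and let $\{0,\dots,k-1\}^*$ and $\{0,\dots,k-1\}^\omega$ be the sets of finite and of infinite words over $\{0,\dots,k-1\}$. Put $nT_{k,r}=\{0,\dots,r-1\}\times(\{0,\dots,k-1\}^*)^n$, $\mathfrak C_{n,k}=(\{0,\dots,k-1\}^\omega)^n$ and $\mathfrak C_{n,k,r}=\{0,\dots,r-1\}\times\mathfrak C_{n,k}$, the latter with the product topology. For $w=(m,(w_i)_{i<n})\in nT_{k,r}$ and $u=(u_i)_{i<n}\in\mathfrak C_{n,k}$ let $wu=(m,(w_iu_i)_{i<n})\in\mathfrak C_{n,k,r}$ (coordinatewise concatenation), and let $\operatorname{cone}(w)=\{wu: u\in\mathfrak C_{n,k}\}$. Order $nT_{k,r}$ by $v\le w$ if $v$ and $w$ have the same first entry and each word of $v$ is a prefix of the corresponding word of $w$. A pseudotree is a finite downwards closed subset $D$ of $nT_{k,r}$ such that the cones of its maximal elements (its leaves) partition $\mathfrak C_{n,k,r}$. Let $tot\,nM_{k,r}$ be the monoid, under composition, of all continuous maps $f:\mathfrak C_{n,k,r}\to\mathfrak C_{n,k,r}$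 for which there are a pseudotree $D$ and a function $h:\operatorname{leaves}(D)\to nT_{k,r}$ such that $f$ maps $du$ to $h(d)u$ for all $d\in\operatorname{leaves}(D)$ and $u\in\mathfrak C_{n,k}$. Then $tot\,nM_{k,r}$ is a finitely presented monoid: it has a monoid presentation with finitely many generators and finitely many defining relations. -/

import Mathlib

/-- Finite shrubberies: a root together with `n` finite words over the alphabet `Fin k`. -/
abbrev Shrubbery (n k r : ℕ) : Type := Fin r × (Fin n → List (Fin k))

/-- The `k`-ary `n`-dimensional Cantor space. -/
abbrev CantorSpace (n k : ℕ) : Type := Fin n → ℕ → Fin k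

/-- The `r`-rooted `k`-ary `n`-dimensional Cantor space, with the product topology
(`Fin r` and `Fin k` are discrete). -/
abbrev RootedCantorSpace (n k r : ℕ) : Type := Fin r × CantorSpace n k

/-- Concatenation of a finite word with an infinite word. -/
def appendWord {k : ℕ} (w : List (Fin k)) (u : ℕ → Fin k) : ℕ → Fin k :=
  fun i => if h : i < w.length then w[i] else u (i - w.length)

namespace Shrubbery

variable {n k r : ℕ}

/-- The concatenation `w u` of a finite shrubbery `w` with an infinite shrub `u`. -/
def append (w : Shrubbery n k r) (u : CantorSpace n k) : RootedCantorSpace n k r :=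
  (w.1, fun i => appendWord (w.2 i) (u i))

/-- The shrubbery order: same root, and coordinatewise prefix. -/
def Below (u v : Shrubbery n k r) : Prop :=
  u.1 = v.1 ∧ ∀ i, u.2 i <+: v.2 i

/-- The cone `w 𝔠` of all points of the rooted Cantor space extending `w`. -/
def cone (w : Shrubbery n k r) : Set (RootedCantorSpace n k r) :=
  Set.range w.append

/-- The maximal elements of a set of shrubberies. -/
def leaves (S : Set (Shrubbery n k r)) : Set (Shrubbery n k r) :=
  {v | v ∈ S ∧ ∀ w ∈ S, Below v w → w = v}

/-- A pseudotree: a finite downwards closed set of shrubberies such that the cones of its leaves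
partition the rooted Cantor space. -/
structure IsPseudotree (T : Set (Shrubbery n k r)) : Prop where
  finite : T.Finite
  down_closed : ∀ v ∈ T, ∀ u, Below u v → u ∈ T
  partition : ∀ x : RootedCantorSpace n k r, ∃! l, l ∈ leaves T ∧ x ∈ cone l

/-- The pair `(D, h)` represents the self-map `f` of the rooted Cantor space: `D` is a pseudotree,
and `f` replaces each leaf prefix `d` of `D` by `h d`. -/
def Represents (D : Set (Shrubbery n k r)) (h : leaves D → Shrubbery n k r)
    (f : RootedCantorSpace n k r → RootedCantorSpace n k r) : Prop :=
  IsPseudotree D ∧ ∀ (d : leaves D) (u : CantorSpace n k), f (d.1.append u) = (h d).append u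

end Shrubbery

/-- The underlying set of the monoid `tot n M_{k,r}`: the continuous self-maps of the rooted Cantor
space which are represented by some pair `(D, h)`. -/
def TotM (n k r : ℕ) : Type :=
  {f : C(RootedCantorSpace n k r, RootedCantorSpace n k r) //
    ∃ (D : Set (Shrubbery n k r)) (h : Shrubbery.leaves D → Shrubbery n k r),
      Shrubbery.Represents D h f}

namespace Shrubbery

variable {n k r : ℕ}

/-- Coordinatewise concatenation of a finite shrubbery and a finite shrub. -/
def appendShrub (w : Shrubbery n k r) (v : Fin n → List (Fin k)) : Shrubbery n k r :=
  (w.1, fun i => w.2 i ++ v i)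

theorem appendWord_append (w v : List (Fin k)) (u : ℕ → Fin k) :
    appendWord (w ++ v) u = appendWord w (appendWord v u) := by
  funext i
  unfold appendWord
  simp only [List.length_append, List.getElem_append]
  by_cases h1 : i < w.length
  · have : i < w.length + v.length := by omega
    simp [h1, this]
  · by_cases h2 : i < w.length + v.length
    · have : i - w.length < v.length := by omega
      simp [h1, h2, this]
    · have : ¬ i - w.length < v.length := by omega
      simp [h1, h2, this, Nat.sub_sub]

theorem append_appendShrub (w : Shrubbery n k r) (v : Fin n → List (Fin k))
    (u : CantorSpace n k) :
    (w.appendShrub v).append u = w.append (fun i => appendWord (v i) (u i)) := by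
  simp [append, appendShrub, appendWord_append]

theorem prefix_of_appendWord_eq {a b : List (Fin k)} {u v : ℕ → Fin k}
    (h : appendWord a u = appendWord b v) (hl : a.length ≤ b.length) : a <+: b := by
  rw [List.prefix_iff_getElem]
  refine ⟨hl, fun i hi => ?_⟩
  have := congrFun h i
  have hb : i < b.length := by omega
  simpa [appendWord, hi, hb] using this

theorem below_of_append_eq {a b : Shrubbery n k r} {u v : CantorSpace n k}
    (h : a.append u = b.append v) (hl : ∀ i, (a.2 i).length ≤ (b.2 i).length) : Below a b := by
  refine ⟨(Prod.ext_iff.mp h).1, fun i => ?_⟩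
  exact prefix_of_appendWord_eq (congrFun (Prod.ext_iff.mp h).2 i) (hl i)

theorem Below.exists_eq {a b : Shrubbery n k r} (h : Below a b) :
    ∃ w, b = a.appendShrub w := by
  choose w hw using h.2
  exact ⟨w, Prod.ext h.1.symm (funext fun i => (hw i).symm)⟩

/-- The full pseudotree of depth `K`. -/
def full (n k r K : ℕ) : Set (Shrubbery n k r) := {w | ∀ i, (w.2 i).length ≤ K}

theorem full_finite (n k r K : ℕ) : (full n k r K).Finite := by
  have h : (Set.univ ×ˢ Set.pi Set.univ fun _ : Fin n => {l : List (Fin k) | l.length ≤ K} :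
      Set (Shrubbery n k r)).Finite :=
    Set.finite_univ.prod (Set.Finite.pi fun _ => List.finite_length_le (Fin k) K)
  refine h.subset fun w hw => ?_
  exact ⟨trivial, fun i _ => hw i⟩

/-- The prefix of length `K` in each coordinate. -/
def trunc (K : ℕ) (x : RootedCantorSpace n k r) : Shrubbery n k r :=
  (x.1, fun i => List.ofFn fun j : Fin K => x.2 i j)

theorem trunc_append (K : ℕ) (x : RootedCantorSpace n k r) :
    (trunc K x).append (fun i j => x.2 i (j + K)) = x := by
  refine Prod.ext rfl (funext fun i => funext fun j => ?_)
  by_cases hj : j < K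
  · simp [append, trunc, appendWord, hj]
  · have : j - K + K = j := by omega
    simp [append, trunc, appendWord, hj, this]

theorem length_trunc (K : ℕ) (x : RootedCantorSpace n k r) (i : Fin n) :
    ((trunc K x).2 i).length = K := by simp [trunc]

theorem trunc_mem_leaves (K : ℕ) (x : RootedCantorSpace n k r) :
    trunc K x ∈ leaves (full n k r K) := by
  refine ⟨fun i => (length_trunc K x i).le, fun w hw hb => ?_⟩
  refine Prod.ext hb.1.symm (funext fun i => ?_)
  exact ((hb.2 i).eq_of_length (le_antisymm (hb.2 i).length_le
    ((hw i).trans (length_trunc K x i).ge))).symm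

theorem eq_trunc_of_mem_leaves {K : ℕ} {l : Shrubbery n k r} (hl : l ∈ leaves (full n k r K))
    (u : CantorSpace n k) : l = trunc K (l.append u) := by
  refine (hl.2 _ (trunc_mem_leaves K _).1 ?_).symm
  refine below_of_append_eq (u := u) (trunc_append K (l.append u)).symm fun i => ?_
  rw [length_trunc]
  exact hl.1 i

theorem isPseudotree_full (n k r K : ℕ) : IsPseudotree (full n k r K) where
  finite := full_finite n k r K
  down_closed v hv u hu i := (hu.2 i).length_le.trans (hv i)
  partition x := by
    refine ⟨trunc K x, ⟨trunc_mem_leaves K x, ⟨_, trunc_append K x⟩⟩, ?_⟩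
    rintro l ⟨hl, u, rfl⟩
    exact eq_trunc_of_mem_leaves hl u

theorem IsPseudotree.exists_bound {D : Set (Shrubbery n k r)} (hD : IsPseudotree D) :
    ∃ N, ∀ w ∈ D, ∀ i, (w.2 i).length ≤ N := by
  obtain ⟨N, hN⟩ := (hD.finite.image fun w => ∑ i, (w.2 i).length).bddAbove
  refine ⟨N, fun w hw i => le_trans ?_ (hN ⟨w, hw, rfl⟩)⟩
  exact Finset.single_le_sum (f := fun i => (w.2 i).length) (fun _ _ => Nat.zero_le _)
    (Finset.mem_univ i)

/-- A represented map acts on every sufficiently deep cone as a prefix replacement. -/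
theorem Represents.exists_deep {D : Set (Shrubbery n k r)} {h : leaves D → Shrubbery n k r}
    {f : RootedCantorSpace n k r → RootedCantorSpace n k r} (hf : Represents D h f) :
    ∃ N, ∀ (M : ℕ) (l : Shrubbery n k r), (∀ i, N + M ≤ (l.2 i).length) →
      ∃ v : Shrubbery n k r, (∀ u, f (l.append u) = v.append u) ∧
        (Nonempty (CantorSpace n k) → ∀ i, M ≤ (v.2 i).length) := by
  obtain ⟨N, hN⟩ := hf.1.exists_bound
  refine ⟨N, fun M l hl => ?_⟩
  by_cases hC : Nonempty (CantorSpace n k)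
  · obtain ⟨u0⟩ := hC
    obtain ⟨d, ⟨hd, u1, hu1⟩, -⟩ := hf.1.partition (l.append u0)
    have hdN := hN d hd.1
    obtain ⟨w, rfl⟩ := (below_of_append_eq hu1
      (fun i => (hdN i).trans (by have := hl i; omega))).exists_eq
    refine ⟨(h ⟨d, hd⟩).appendShrub w, fun u => ?_, fun _ i => ?_⟩
    · rw [append_appendShrub, append_appendShrub]
      exact hf.2 ⟨d, hd⟩ _
    · have h1 := hl i
      have h2 := hdN i
      simp only [appendShrub, List.length_append] at h1 ⊢
      omega
  · exact ⟨l, fun u => (hC ⟨u⟩).elim, fun h => (hC h).elim⟩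

theorem exists_represents_comp {f g : RootedCantorSpace n k r → RootedCantorSpace n k r}
    (hf : ∃ (D : Set (Shrubbery n k r)) (h : leaves D → Shrubbery n k r), Represents D h f)
    (hg : ∃ (D : Set (Shrubbery n k r)) (h : leaves D → Shrubbery n k r), Represents D h g) :
    ∃ (D : Set (Shrubbery n k r)) (h : leaves D → Shrubbery n k r), Represents D h (g ∘ f) := by
  obtain ⟨D, h, hf⟩ := hf
  obtain ⟨E, h', hg⟩ := hg
  obtain ⟨N, hN⟩ := hf.exists_deep
  obtain ⟨M, hM⟩ := hg.exists_deep
  have key : ∀ l : leaves (full n k r (N + M)), ∃ v : Shrubbery n k r,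
      ∀ u, (g ∘ f) (l.1.append u) = v.append u := by
    rintro ⟨l, hl⟩
    by_cases hC : Nonempty (CantorSpace n k)
    · obtain ⟨u0⟩ := hC
      have hlen : ∀ i, N + M ≤ (l.2 i).length := fun i => by
        rw [eq_trunc_of_mem_leaves hl u0, length_trunc]
      obtain ⟨v, hv, hvM⟩ := hN M l hlen
      obtain ⟨v', hv', -⟩ := hM 0 v (hvM ⟨u0⟩)
      exact ⟨v', fun u => by simp [hv, hv']⟩
    · exact ⟨l, fun u => (hC ⟨u⟩).elim⟩
  choose v hv using key
  exact ⟨_, v, isPseudotree_full n k r (N + M), hv⟩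

end Shrubbery

/-- The monoid structure on `tot n M_{k,r}`. Maps act on the right, so `f * g` is `f` followed
by `g`. -/
instance TotM.instMonoid (n k r : ℕ) : Monoid (TotM n k r) where
  one := ⟨ContinuousMap.id _, Shrubbery.full n k r 0, Subtype.val,
    Shrubbery.isPseudotree_full n k r 0, fun _ _ => rfl⟩
  mul f g := ⟨g.1.comp f.1, Shrubbery.exists_represents_comp (f := f.1) (g := g.1) f.2 g.2⟩
  one_mul _ := rfl
  mul_one _ := rfl
  mul_assoc _ _ _ := rfl

/-- A monoid is finitely presented if it has a monoid presentation with finitely many generators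
and finitely many relations. -/
def Monoid.IsFinitelyPresented (M : Type*) [Monoid M] : Prop :=
  ∃ (m : ℕ) (R : Set (FreeMonoid (Fin m) × FreeMonoid (Fin m))),
    R.Finite ∧ Nonempty (PresentedMonoid (fun a b => (a, b) ∈ R) ≃* M)

/-! Products are read from left to right, as maps acting on the right. Multiplying `f` on the left
by `pushProd push w * root l` restricts `f` to a cone. On a deep enough cone `f` replaces a prefix,
so the product is a normal form `pushProd push v * root l'`, and normal forms are pairwise distinct.
Hence `f` is determined by finitely many normal forms. It remains to make this reasoning available
to finitely many generators and relations.

The device is a splitting `d * glue y' * fold = y`: choose a branch, act on it by `y' a`, forget the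
branch. Since `glue (fun _ => f) * fold = fold * f`, the products `y' a * f` then determine `y * f`.
Finitely many splittings suffice: `1` splits into the letters `push i a` of any one coordinate, and
`initial (m + 1)` splits into `initial m` and `root m`.

Only `glue` has infinitely many values to control. It is a product of conjugates by `swap a` of the
action `onBase` on one branch, and `onBase` of `onBase` is `onBase` conjugated by `shift`. A finite
set of generators, or of relations, therefore needs only one further copy under `onBase`
(`exists_fg_submonoid`, `exists_onBase_lift`).

With this, splittings also work in a finitely presented cover of the monoid
(`exists_presentation_separating`). Two elements of the cover with the same image have equal normal
forms on all deep cones, and splittings carry this equality back to the elements themselves. -/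

/-! ### Ordered products of commuting families -/

section OrderedProduct

variable {k : ℕ} {M N : Type*} [Monoid M] [Monoid N]

/-- The product of a family indexed by `Fin k`, taken in increasing order of the indices. -/
def orderedProd (f : Fin k → M) : M := ((List.finRange k).map f).prod

theorem map_orderedProd (φ : M →* N) (f : Fin k → M) :
    φ (orderedProd f) = orderedProd fun a => φ (f a) := by
  simp [orderedProd, map_list_prod, Function.comp_def]

/-- Each `g a` only has to move past the `f b` with `b` later in the list. As the list has no
duplicates, `f a` and `g a` themselves need not commute. -/
theorem List.prod_map_mul_of_commute {ι : Type*} {f g : ι → M} {l : List ι} (hl : l.Nodup)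
    (h : ∀ a b, a ≠ b → Commute (f a) (g b)) :
    (l.map fun a => f a * g a).prod = (l.map f).prod * (l.map g).prod := by
  induction l with
  | nil => simp
  | cons a l ih =>
    obtain ⟨ha, hl⟩ := List.nodup_cons.mp hl
    have hc : Commute (g a) (l.map f).prod := by
      refine Commute.list_prod_right _ _ fun x hx => ?_
      obtain ⟨b, hb, rfl⟩ := List.mem_map.mp hx
      exact (h b a (by rintro rfl; exact ha hb)).symm
    simp only [List.map_cons, List.prod_cons, ih hl]
    rw [mul_assoc, ← mul_assoc (g a), hc.eq]
    simp only [mul_assoc]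

theorem orderedProd_mul {f g : Fin k → M} (h : ∀ a b, a ≠ b → Commute (f a) (g b)) :
    orderedProd (fun a => f a * g a) = orderedProd f * orderedProd g :=
  List.prod_map_mul_of_commute (List.nodup_finRange k) h

theorem orderedProd_mem (S : Submonoid M) {f : Fin k → M} (h : ∀ a, f a ∈ S) :
    orderedProd f ∈ S :=
  Submonoid.list_prod_mem _ fun x hx => by
    obtain ⟨a, -, rfl⟩ := List.mem_map.mp hx
    exact h a

theorem orderedProd_mulSingle (f : Fin k → M) :
    orderedProd (fun a => Pi.mulSingle a (f a)) = f := by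
  have key : ∀ (l : List (Fin k)), l.Nodup → ∀ b,
      (l.map fun a => Pi.mulSingle (M := fun _ => M) a (f a)).prod b = if b ∈ l then f b else 1 := by
    intro l hl b
    induction l with
    | nil => simp
    | cons a l ih =>
      obtain ⟨ha, hl⟩ := List.nodup_cons.mp hl
      rw [List.map_cons, List.prod_cons, Pi.mul_apply, ih hl]
      by_cases hb : b = a
      · subst hb; simp [ha]
      · simp [hb]
  funext b
  simpa [orderedProd] using key _ (List.nodup_finRange k) b

end OrderedProduct

/-! ### Branch systems, splittings and finite generation -/

/-- A monoid with a copairing: `glue` lets `k` elements act side by side on `k` branches,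
`fold` identifies all branches, `swap a` exchanges the branch `a` with the branch `base`,
and `shift` carries the branch `base` to the branch `base` of the branch `base`. -/
structure BranchSystem (k : ℕ) (M : Type*) [Monoid M] where
  /-- Independent action on the branches. -/
  glue : (Fin k → M) →* M
  /-- Identification of all branches. -/
  fold : M
  /-- A distinguished branch. -/
  base : Fin k
  /-- The exchange of a branch with the distinguished one. -/
  swap : Fin k → Mˣ
  /-- The contraction of the distinguished branch into its own distinguished branch. -/
  shift : Mˣ
  glue_mulSingle : ∀ a f, glue (Pi.mulSingle a f) =
    ↑(swap a)⁻¹ * glue (Pi.mulSingle base f) * ↑(swap a)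
  glue_base_base : ∀ f, glue (Pi.mulSingle base (glue (Pi.mulSingle base f))) =
    ↑shift⁻¹ * glue (Pi.mulSingle base f) * ↑shift
  glue_const_fold : ∀ f, glue (fun _ => f) * fold = fold * f

/-- Conjugation by a unit of a monoid, as an endomorphism. -/
def Units.conjHom {M : Type*} [Monoid M] (c : Mˣ) : M →* M where
  toFun x := ↑c⁻¹ * x * ↑c
  map_one' := by simp
  map_mul' x y := by simp [mul_assoc]

@[simp] theorem Units.conjHom_apply {M : Type*} [Monoid M] (c : Mˣ) (x : M) :
    c.conjHom x = ↑c⁻¹ * x * ↑c := rfl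

namespace BranchSystem

variable {k : ℕ} {M : Type*} [Monoid M] (B : BranchSystem k M)

/-- The action of an element on the distinguished branch only. -/
def onBase : M →* M := B.glue.comp (MonoidHom.mulSingle (fun _ => M) B.base)

theorem onBase_apply (f : M) : B.onBase f = B.glue (Pi.mulSingle B.base f) := rfl

/-- This is the source of all finiteness: on its own image `onBase` is an inner operation, so
iterating it creates nothing new. -/
theorem onBase_onBase (f : M) :
    B.onBase (B.onBase f) = ↑B.shift⁻¹ * B.onBase f * ↑B.shift := B.glue_base_base f

theorem glue_eq_orderedProd (f : Fin k → M) :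
    B.glue f = orderedProd fun a => ↑(B.swap a)⁻¹ * B.onBase (f a) * ↑(B.swap a) := by
  conv_lhs => rw [← orderedProd_mulSingle f, map_orderedProd]
  exact congrArg orderedProd (funext fun a => B.glue_mulSingle a (f a))

theorem commute_branches {a b : Fin k} (hab : a ≠ b) (f g : M) :
    Commute (↑(B.swap a)⁻¹ * B.onBase f * ↑(B.swap a)) (↑(B.swap b)⁻¹ * B.onBase g * ↑(B.swap b)) := by
  rw [onBase_apply, onBase_apply, ← B.glue_mulSingle, ← B.glue_mulSingle]
  exact (Pi.mulSingle_commute hab f g).map B.glue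

/-- A splitting `(d, y', y)` expresses `y` through the elements `y' a` acting on the branches. -/
def IsSplitting (d : M) (y' : Fin k → M) (y : M) : Prop := d * B.glue y' * B.fold = y

/-- A right factor `f` crosses `fold` and reappears identically on every branch, so one splitting of
`y` serves all multiples `y * f`. -/
theorem IsSplitting.mul {d : M} {y' : Fin k → M} {y : M} (h : B.IsSplitting d y' y) (f : M) :
    B.IsSplitting d (fun a => y' a * f) (y * f) := by
  have : (fun a => y' a * f) = y' * fun _ => f := rfl
  unfold IsSplitting at h ⊢
  rw [this, map_mul, ← h]
  simp only [mul_assoc, B.glue_const_fold]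

/-- Every finite set is contained in a finitely generated submonoid which is closed under
splittings with first component in that submonoid. -/
theorem exists_fg_submonoid {S : Set M} (hS : S.Finite) :
    ∃ H : Submonoid M, H.FG ∧ S ⊆ H ∧ ∀ d ∈ H, ∀ y' y, B.IsSplitting d y' y →
      (∀ a, y' a ∈ H) → y ∈ H := by
  let S₁ : Set M := S ∪ {↑B.shift, ↑B.shift⁻¹, B.fold} ∪
    (Set.range (fun a => (↑(B.swap a) : M)) ∪ Set.range (fun a => (↑(B.swap a)⁻¹ : M)))
  have hS₁ : S₁.Finite := (hS.union (by simp)).union ((Set.finite_range _).union (Set.finite_range _))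
  -- One image under `onBase` is enough for closure under `onBase`: a second application is
  -- conjugation by `shift`, and both `shift` and its inverse lie in `S₁`.
  let H := Submonoid.closure (S₁ ∪ B.onBase '' S₁)
  have hmem : ∀ s ∈ S₁, s ∈ H := fun s hs => Submonoid.subset_closure (Or.inl hs)
  have hbase : ∀ s ∈ H, B.onBase s ∈ H := by
    intro s hs
    induction hs using Submonoid.closure_induction with
    | mem x hx =>
      rcases hx with hx | ⟨x, hx, rfl⟩
      · exact Submonoid.subset_closure (Or.inr ⟨x, hx, rfl⟩)
      · rw [B.onBase_onBase]
        exact H.mul_mem (H.mul_mem (hmem _ (by simp [S₁]))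
          (Submonoid.subset_closure (Or.inr ⟨x, hx, rfl⟩))) (hmem _ (by simp [S₁]))
    | one => simp
    | mul x y _ _ hx hy => simpa using H.mul_mem hx hy
  refine ⟨H, (Submonoid.fg_iff _).mpr ⟨_, rfl, hS₁.union (hS₁.image _)⟩,
    fun s hs => hmem s (Or.inl (Or.inl hs)), ?_⟩
  rintro d hd y' y rfl hy
  refine H.mul_mem (H.mul_mem hd ?_) (hmem _ (by simp [S₁]))
  rw [B.glue_eq_orderedProd]
  exact orderedProd_mem _ fun a => H.mul_mem (H.mul_mem (hmem _ (by simp [S₁])) (hbase _ (hy a)))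
    (hmem _ (by simp [S₁]))

variable {m : ℕ} {ρ : FreeMonoid (Fin m) →* M} {sec : M → FreeMonoid (Fin m)}

/-- A lift of `onBase` to words in generators. -/
def onBaseWord (ρ : FreeMonoid (Fin m) →* M) (sec : M → FreeMonoid (Fin m)) :
    FreeMonoid (Fin m) →* FreeMonoid (Fin m) :=
  FreeMonoid.lift fun s => sec (B.onBase (ρ (FreeMonoid.of s)))

theorem map_onBaseWord (hsec : ∀ f, ρ (sec f) = f) (w : FreeMonoid (Fin m)) :
    ρ (B.onBaseWord ρ sec w) = B.onBase (ρ w) := by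
  have : ρ.comp (B.onBaseWord ρ sec) = B.onBase.comp ρ :=
    FreeMonoid.hom_eq fun s => by simp [onBaseWord, hsec]
  exact DFunLike.congr_fun this w

/-- A lift of the action on a single branch to words in generators. -/
def branchWord (ρ : FreeMonoid (Fin m) →* M) (sec : M → FreeMonoid (Fin m)) (a : Fin k)
    (w : FreeMonoid (Fin m)) : FreeMonoid (Fin m) :=
  sec ↑(B.swap a)⁻¹ * B.onBaseWord ρ sec w * sec ↑(B.swap a)

theorem map_branchWord (hsec : ∀ f, ρ (sec f) = f) (a : Fin k) (w : FreeMonoid (Fin m)) :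
    ρ (B.branchWord ρ sec a w) = ↑(B.swap a)⁻¹ * B.onBase (ρ w) * ↑(B.swap a) := by
  simp [branchWord, hsec, B.map_onBaseWord hsec]

theorem map_orderedProd_branchWord (hsec : ∀ f, ρ (sec f) = f) (w : Fin k → FreeMonoid (Fin m)) :
    ρ (orderedProd fun a => B.branchWord ρ sec a (w a)) = B.glue fun a => ρ (w a) := by
  simp only [map_orderedProd, B.map_branchWord hsec, B.glue_eq_orderedProd]

end BranchSystem

/-! ### Finite sets of relations under which splittings still determine products -/

/-- The monoid presented by a set of pairs of words. -/
abbrev PresentedBy {m : ℕ} (R : Set (FreeMonoid (Fin m) × FreeMonoid (Fin m))) : Type :=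
  PresentedMonoid fun a b => (a, b) ∈ R

namespace PresentedBy

variable {m : ℕ} {R : Set (FreeMonoid (Fin m) × FreeMonoid (Fin m))}

/-- The element of the presented monoid represented by a word. -/
def ofWord (R : Set (FreeMonoid (Fin m) × FreeMonoid (Fin m))) : FreeMonoid (Fin m) →* PresentedBy R :=
  PresentedMonoid.mk _

theorem ofWord_surjective : Function.Surjective (ofWord R) := PresentedMonoid.surjective_mk

theorem ofWord_eq {u v : FreeMonoid (Fin m)} (h : (u, v) ∈ R) : ofWord R u = ofWord R v :=
  PresentedMonoid.mk_eq_mk_of_rel h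

theorem exists_lift {N : Type*} [Monoid N] (φ : FreeMonoid (Fin m) →* N)
    (h : ∀ p ∈ R, φ p.1 = φ p.2) : ∃ ψ : PresentedBy R →* N, ∀ w, ψ (ofWord R w) = φ w := by
  have hle : conGen (fun a b => (a, b) ∈ R) ≤ Con.ker φ := Con.conGen_le.mpr fun a b hab => h _ hab
  exact ⟨Con.lift _ φ hle, fun w => Con.lift_mk' hle w⟩

end PresentedBy

namespace BranchSystem

open PresentedBy

variable {k : ℕ} {M : Type*} [Monoid M] (B : BranchSystem k M)
variable {m : ℕ} {ρ : FreeMonoid (Fin m) →* M} {sec : M → FreeMonoid (Fin m)}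

/-- Finitely many relations can be enlarged to a finite set of relations such that `onBase`
descends to the presented monoid. -/
theorem exists_onBase_lift (hsec : ∀ f, ρ (sec f) = f)
    {T : Set (FreeMonoid (Fin m) × FreeMonoid (Fin m))} (hT : T.Finite)
    (hTρ : ∀ p ∈ T, ρ p.1 = ρ p.2) :
    ∃ R : Set (FreeMonoid (Fin m) × FreeMonoid (Fin m)), R.Finite ∧ T ⊆ R ∧
      (∀ p ∈ R, ρ p.1 = ρ p.2) ∧
      ∃ σ : PresentedBy R →* PresentedBy R, ∀ w, σ (ofWord R w) = ofWord R (B.onBaseWord ρ sec w) := by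
  let s := B.onBaseWord ρ sec
  let W := FreeMonoid (Fin m)
  -- The conjugation rule is imposed on generators only: both sides are homomorphisms once `shift`
  -- is made invertible by the two relations before it.
  let T' : Set (W × W) := T ∪ {(sec ↑B.shift * sec ↑B.shift⁻¹, 1), (sec ↑B.shift⁻¹ * sec ↑B.shift, 1)}
    ∪ Set.range fun t : Fin m => (s (s (FreeMonoid.of t)),
      sec ↑B.shift⁻¹ * s (FreeMonoid.of t) * sec ↑B.shift)
  have hT'ρ : ∀ p ∈ T', ρ p.1 = ρ p.2 := by
    rintro p ((hp | rfl | rfl) | ⟨t, rfl⟩)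
    · exact hTρ p hp
    · simp [hsec]
    · simp [hsec]
    · simp [s, hsec, B.map_onBaseWord hsec, B.onBase_onBase]
  have hs : ∀ w, ρ (s w) = B.onBase (ρ w) := B.map_onBaseWord hsec
  let R := T' ∪ Prod.map s s '' T'
  have hR : ∀ p ∈ T', ofWord R p.1 = ofWord R p.2 := fun p hp => ofWord_eq (Or.inl hp)
  have hR' : ∀ p ∈ T', ofWord R (s p.1) = ofWord R (s p.2) := fun p hp => ofWord_eq (Or.inr ⟨p, hp, rfl⟩)
  let c : (PresentedBy R)ˣ := ⟨ofWord R (sec ↑B.shift), ofWord R (sec ↑B.shift⁻¹),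
    by simpa using hR (sec ↑B.shift * sec ↑B.shift⁻¹, 1) (by simp [T']),
    by simpa using hR (sec ↑B.shift⁻¹ * sec ↑B.shift, 1) (by simp [T'])⟩
  have hconj : ((ofWord R).comp s).comp s = c.conjHom.comp ((ofWord R).comp s) :=
    FreeMonoid.hom_eq fun t => by
      simpa [c] using hR (s (s (FreeMonoid.of t)), _) (Or.inr ⟨t, rfl⟩)
  have hss : ∀ w, ofWord R (s (s w)) = c.conjHom (ofWord R (s w)) := fun w => DFunLike.congr_fun hconj w
  have hT' : T'.Finite := (hT.union (by simp)).union (Set.finite_range _)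
  refine ⟨R, hT'.union (hT'.image _), fun p hp => Or.inl (Or.inl (Or.inl hp)), ?_,
    exists_lift ((ofWord R).comp s) ?_⟩
  · rintro p (hp | ⟨p, hp, rfl⟩)
    · exact hT'ρ p hp
    · simp [hs, hT'ρ p hp]
  · rintro p (hp | ⟨p, hp, rfl⟩)
    · exact hR' p hp
    -- For a relation already lifted once, a second lift is a conjugate of the first and follows
    -- from it.
    · simp [hss, hR' p hp]

/-- Finitely many relations can be enlarged to a finite set of relations such that, for finitely
many given splittings `(d, y', y)`, the elements `y' a` jointly determine `y` in the presented
monoid. -/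
theorem exists_presentation_separating (hsec : ∀ f, ρ (sec f) = f) {Λ : Type*} [Finite Λ]
    {d : Λ → M} {y' : Λ → Fin k → M} {y : Λ → M} (hy : ∀ i, B.IsSplitting (d i) (y' i) (y i))
    {T : Set (FreeMonoid (Fin m) × FreeMonoid (Fin m))} (hT : T.Finite)
    (hTρ : ∀ p ∈ T, ρ p.1 = ρ p.2) :
    ∃ R : Set (FreeMonoid (Fin m) × FreeMonoid (Fin m)), R.Finite ∧ T ⊆ R ∧
      (∀ p ∈ R, ρ p.1 = ρ p.2) ∧
      ∀ (i : Λ) (g h : PresentedBy R),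
        (∀ a, ofWord R (sec (y' i a)) * g = ofWord R (sec (y' i a)) * h) →
        ofWord R (sec (y i)) * g = ofWord R (sec (y i)) * h := by
  let W := FreeMonoid (Fin m)
  let b := B.branchWord ρ sec
  let T₁ : Set (W × W) := Set.range fun a => (sec ↑(B.swap a) * sec ↑(B.swap a)⁻¹, 1)
  let T₂ : Set (W × W) := Set.range fun a => (sec ↑(B.swap a)⁻¹ * sec ↑(B.swap a), 1)
  let T₃ : Set (W × W) := Set.range fun q : {q : Fin k × Fin k // q.1 ≠ q.2} × Fin m × Fin m =>
    (b q.1.1.1 (.of q.2.1) * b q.1.1.2 (.of q.2.2), b q.1.1.2 (.of q.2.2) * b q.1.1.1 (.of q.2.1))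
  let T₄ : Set (W × W) := Set.range fun t : Fin m =>
    ((orderedProd fun a => b a (.of t)) * sec B.fold, sec B.fold * .of t)
  let T₅ : Set (W × W) := Set.range fun i : Λ =>
    (sec (d i) * (orderedProd fun a => b a (sec (y' i a))) * sec B.fold, sec (y i))
  obtain ⟨R, hR, hTR, hRρ, σ, hσ⟩ := B.exists_onBase_lift hsec (T := T ∪ (T₁ ∪ T₂ ∪ T₃ ∪ T₄ ∪ T₅))
    (hT.union (((((Set.finite_range _).union (Set.finite_range _)).union
      (Set.finite_range _)).union (Set.finite_range _)).union (Set.finite_range _))) (by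
    rintro p (hp | (((⟨a, rfl⟩ | ⟨a, rfl⟩) | ⟨⟨⟨q, hq⟩, t, t'⟩, rfl⟩) | ⟨t, rfl⟩) | ⟨i, rfl⟩)
    · exact hTρ p hp
    · simp [hsec]
    · simp [hsec]
    · simpa [b, B.map_branchWord hsec] using (B.commute_branches hq _ _).eq
    · simp only [b, map_mul, B.map_orderedProd_branchWord hsec, hsec, B.glue_const_fold]
    · simp only [b, map_mul, B.map_orderedProd_branchWord hsec, hsec]
      exact hy i)
  obtain ⟨hTR, hR'⟩ := Set.union_subset_iff.mp hTR
  refine ⟨R, hR, hTR, hRρ, ?_⟩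
  simp only [Set.union_subset_iff] at hR'
  obtain ⟨⟨⟨⟨h₁, h₂⟩, h₃⟩, h₄⟩, h₅⟩ := hR'
  let τ (a : Fin k) : (PresentedBy R)ˣ := ⟨ofWord R (sec ↑(B.swap a)), ofWord R (sec ↑(B.swap a)⁻¹),
    by rw [← map_mul, ← map_one (ofWord R)]; exact ofWord_eq (h₁ ⟨a, rfl⟩),
    by rw [← map_mul, ← map_one (ofWord R)]; exact ofWord_eq (h₂ ⟨a, rfl⟩)⟩
  let β (a : Fin k) : PresentedBy R →* PresentedBy R := (τ a).conjHom.comp σ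
  have hβ : ∀ a w, ofWord R (b a w) = β a (ofWord R w) := fun a w => by
    simp [b, branchWord, β, τ, hσ]
  have hcomm : ∀ {a a' : Fin k}, a ≠ a' → ∀ g h, Commute (β a g) (β a' h) := by
    intro a a' ha g h
    obtain ⟨u, rfl⟩ := ofWord_surjective g
    obtain ⟨v, rfl⟩ := ofWord_surjective h
    -- Each `β a` is a homomorphism, so commutation on pairs of generators, given by `T₃`, extends
    -- to all elements.
    induction u using FreeMonoid.inductionOn with
    | one => simp
    | mul u u' hu hu' => simpa using hu.mul_left hu'
    | of t =>
      induction v using FreeMonoid.inductionOn with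
      | one => simp
      | mul v v' hv hv' => simpa using hv.mul_right hv'
      | of t' =>
        have := ofWord_eq (h₃ ⟨(⟨(a, a'), ha⟩, t, t'), rfl⟩)
        simp only [map_mul, hβ] at this
        exact this
  let γ : (Fin k → PresentedBy R) →* PresentedBy R :=
    { toFun := fun g => orderedProd fun a => β a (g a)
      map_one' := by simp [orderedProd]
      map_mul' := fun g h => by
        simp only [Pi.mul_apply, map_mul]
        exact orderedProd_mul fun a a' ha => hcomm ha _ _ }
  have hfold : ∀ g, γ (fun _ => g) * ofWord R (sec B.fold) = ofWord R (sec B.fold) * g := by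
    intro g
    obtain ⟨u, rfl⟩ := ofWord_surjective g
    induction u using FreeMonoid.inductionOn with
    | one =>
      have : (fun _ : Fin k => ofWord R 1) = 1 := by funext; simp
      rw [this, map_one, map_one, one_mul, mul_one]
    | mul u v hu hv =>
      have : (fun _ : Fin k => ofWord R (u * v)) = (fun _ => ofWord R u) * fun _ => ofWord R v := by
        funext; simp
      rw [this, map_mul, mul_assoc, hv, ← mul_assoc, hu, mul_assoc, map_mul]
    | of t =>
      have := ofWord_eq (h₄ ⟨t, rfl⟩)
      simp only [map_mul, map_orderedProd, hβ] at this
      exact this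
  -- The relation from `T₅` times `g`: by `hfold` the factor `g` moves in front of the fold and into
  -- each branch, so the right side sees `g` only through the products with `y' i a`.
  have hsplit : ∀ (i : Λ) g, ofWord R (sec (y i)) * g =
      ofWord R (sec (d i)) * γ (fun a => ofWord R (sec (y' i a)) * g) * ofWord R (sec B.fold) := by
    intro i g
    have h := ofWord_eq (h₅ ⟨i, rfl⟩)
    simp only [map_mul, map_orderedProd, hβ] at h
    have hγ : γ (fun a => ofWord R (sec (y' i a)) * g) =
        γ (fun a => ofWord R (sec (y' i a))) * γ fun _ => g := (map_mul γ _ _).symm ▸ rfl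
    rw [← h, hγ]
    simp only [mul_assoc, hfold]
    rfl
  intro i g h hgh
  rw [hsplit, hsplit, funext hgh]

end BranchSystem

/-! ### Products of letters and reduction to long prefixes -/

section PushProduct

variable {n k r : ℕ} {M N : Type*} [Monoid M] [Monoid N]

theorem orderedProd_mulSingle_const (i : Fin k) (y : M) :
    orderedProd (Pi.mulSingle (M := fun _ => M) i y) = y := by
  have key : ∀ l : List (Fin k), l.Nodup →
      (l.map (Pi.mulSingle (M := fun _ => M) i y)).prod = if i ∈ l then y else 1 := by
    intro l hl
    induction l with
    | nil => simp
    | cons a l ih =>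
      obtain ⟨ha, hl⟩ := List.nodup_cons.mp hl
      rw [List.map_cons, List.prod_cons, ih hl]
      by_cases hi : i = a
      · subst hi; simp [ha]
      · simp [hi]
  simpa [orderedProd] using key _ (List.nodup_finRange k)

/-- The product of the elements `x a` over the letters `a` of a word, the last letter first. -/
def wordProd (x : Fin k → M) (w : List (Fin k)) : M := (w.reverse.map x).prod

theorem wordProd_append (x : Fin k → M) (v w : List (Fin k)) :
    wordProd x (v ++ w) = wordProd x w * wordProd x v := by simp [wordProd]

theorem commute_wordProd {x : Fin k → M} {y : M} (h : ∀ a, Commute y (x a)) (w : List (Fin k)) :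
    Commute y (wordProd x w) :=
  Commute.list_prod_right _ _ fun z hz => by
    obtain ⟨a, -, rfl⟩ := List.mem_map.mp hz
    exact h a

/-- The product of `wordProd (x i) (w i)` over all coordinates `i`. -/
def pushProd (x : Fin n → Fin k → M) (w : Fin n → List (Fin k)) : M :=
  orderedProd fun i => wordProd (x i) (w i)

theorem map_pushProd (φ : M →* N) (x : Fin n → Fin k → M) (w : Fin n → List (Fin k)) :
    φ (pushProd x w) = pushProd (fun i a => φ (x i a)) w := by
  simp [pushProd, map_orderedProd, wordProd, map_list_prod, Function.comp_def]

theorem pushProd_mem (H : Submonoid M) {x : Fin n → Fin k → M} (hx : ∀ i a, x i a ∈ H)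
    (w : Fin n → List (Fin k)) : pushProd x w ∈ H :=
  orderedProd_mem _ fun i => Submonoid.list_prod_mem _ fun z hz => by
    obtain ⟨a, -, rfl⟩ := List.mem_map.mp hz
    exact hx i a

theorem pushProd_nil (x : Fin n → Fin k → M) : pushProd x (fun _ => []) = 1 := by
  simp [pushProd, wordProd, orderedProd]

theorem pushProd_single (x : Fin n → Fin k → M) (i : Fin n) (a : Fin k) :
    pushProd x (Function.update (fun _ => []) i [a]) = x i a := by
  rw [← orderedProd_mulSingle_const i (x i a), pushProd]
  congr 1
  funext j
  by_cases hj : j = i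
  · subst hj; simp [wordProd]
  · simp [wordProd, hj]

theorem pushProd_append {x : Fin n → Fin k → M}
    (hx : ∀ i j, i ≠ j → ∀ a b, Commute (x i a) (x j b)) (v w : Fin n → List (Fin k)) :
    pushProd x (fun i => v i ++ w i) = pushProd x w * pushProd x v := by
  simp only [pushProd, wordProd_append]
  exact orderedProd_mul fun i j hij =>
    commute_wordProd (fun b => (commute_wordProd (fun a => (hx i j hij a b).symm) _).symm) _

/-- A property that can be checked after pushing a letter to any given coordinate, and after
passing to any root, can be checked after pushing all sufficiently long words. -/
theorem of_forall_long_words {α : Type*} [MulAction M α] {Q : α → Prop}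
    {x : Fin n → Fin k → M} {root : Fin r → M}
    (hx : ∀ i j, i ≠ j → ∀ a b, Commute (x i a) (x j b))
    (hr : ∀ l i a, Commute (root l) (x i a))
    (hQx : ∀ i y, (∀ a, Q (x i a • y)) → Q y) (hQr : ∀ y, (∀ l, Q (root l • y)) → Q y)
    (K : Fin n → ℕ) (y : α)
    (h : ∀ w l, (∀ i, K i ≤ (w i).length) → Q ((pushProd x w * root l) • y)) : Q y := by
  induction hs : ∑ i, K i generalizing K y with
  | zero =>
    have hK : ∀ i, K i = 0 := fun i => (Finset.sum_eq_zero_iff.mp hs) i (Finset.mem_univ i)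
    refine hQr y fun l => ?_
    simpa [pushProd_nil] using h (fun _ => []) l (by simp [hK])
  | succ s ih =>
    obtain ⟨i, hi⟩ : ∃ i, K i ≠ 0 := by
      by_contra! hK
      simp [hK] at hs
    -- Passing from `y` to `x i a • y` puts the letter `a` in front of every word in coordinate `i`,
    -- so the length required there drops by one.
    refine hQx i y fun a => ih (Function.update K i (K i - 1)) _ (fun w l hw => ?_) ?_
    · have hp : pushProd x w * root l * x i a =
          pushProd x (fun j => Function.update (fun _ => []) i [a] j ++ w j) * root l := by
        rw [pushProd_append hx, pushProd_single, mul_assoc, mul_assoc, (hr l i a).eq]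
      rw [← mul_smul, hp]
      refine h _ l fun j => ?_
      have := hw j
      by_cases hj : j = i
      · subst hj
        simp at this ⊢
        omega
      · simpa [hj] using this
    · have h1 := Finset.sum_update_of_mem (Finset.mem_univ i) K (K i - 1)
      have h2 := Finset.sum_update_of_mem (Finset.mem_univ i) K (K i)
      rw [Function.update_eq_self] at h2
      omega

/-- An element is deep if it replaces every sufficiently long prefix by another prefix. -/
def IsDeep (x : Fin n → Fin k → M) (root : Fin r → M) (g : M) : Prop :=
  ∃ K, ∀ L w l, (∀ i, K + L ≤ (w i).length) → ∃ v l', (∀ i, L ≤ (v i).length) ∧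
    pushProd x w * root l * g = pushProd x v * root l'

theorem IsDeep.one (x : Fin n → Fin k → M) (root : Fin r → M) : IsDeep x root 1 :=
  ⟨0, fun L w l hw => ⟨w, l, fun i => by simpa using hw i, mul_one _⟩⟩

theorem IsDeep.mul {x : Fin n → Fin k → M} {root : Fin r → M} {g h : M}
    (hg : IsDeep x root g) (hh : IsDeep x root h) : IsDeep x root (g * h) := by
  obtain ⟨K, hK⟩ := hg
  obtain ⟨K', hK'⟩ := hh
  refine ⟨K + K', fun L w l hw => ?_⟩
  obtain ⟨v, l₁, hv, e⟩ := hK (K' + L) w l fun i => by have := hw i; omega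
  obtain ⟨v', l₂, hv', e'⟩ := hK' L v l₁ hv
  exact ⟨v', l₂, hv', by rw [← mul_assoc, e, e']⟩

/-- The first `K` letters are consumed by `g`; the remaining letters, at least `L` of them, survive
as the tail of the output and give its length bound. -/
theorem IsDeep.of_exact {x : Fin n → Fin k → M} {root : Fin r → M} {g : M}
    (hx : ∀ i j, i ≠ j → ∀ a b, Commute (x i a) (x j b)) (K : ℕ)
    (h : ∀ w l, (∀ i, (w i).length = K) → ∃ v l',
      pushProd x w * root l * g = pushProd x v * root l') : IsDeep x root g := by
  refine ⟨K, fun L w l hw => ?_⟩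
  obtain ⟨v, l', e⟩ := h (fun i => (w i).take K) l fun i => by have := hw i; simp; omega
  refine ⟨fun i => v i ++ (w i).drop K, l', fun i => ?_, ?_⟩
  · have := hw i
    simp only [List.length_append, List.length_drop]
    omega
  · have hsplit : pushProd x w =
        pushProd x (fun i => (w i).drop K) * pushProd x (fun i => (w i).take K) := by
      rw [← pushProd_append hx]
      simp
    rw [pushProd_append hx, hsplit, mul_assoc, mul_assoc, ← mul_assoc _ (root l), e, mul_assoc]

end PushProduct

/-! ### Prefix systems and their finite presentation -/

/-- A branch system together with elements `push i a` which prepend letters, projections `root l`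
to the roots, and splittings which reduce every element to its actions on prefixes. -/
structure PrefixSystem (n k r : ℕ) (M : Type*) [Monoid M] extends BranchSystem k M where
  /-- Prepending a letter to a coordinate. -/
  push : Fin n → Fin k → M
  /-- Replacing the root. -/
  root : Fin r → M
  push_commute : ∀ i j, i ≠ j → ∀ a b, Commute (push i a) (push j b)
  root_commute : ∀ l i a, Commute (root l) (push i a)
  pushProd_root_injective : ∀ {v w l l'},
    pushProd push v * root l = pushProd push w * root l' → v = w ∧ l = l'
  exists_depth : ∀ f, ∃ K, ∀ w l, (∀ i, (w i).length = K) → ∃ v l',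
    pushProd push w * root l * f = pushProd push v * root l'
  /-- The first component of a splitting along a coordinate. -/
  split : Fin n → M
  isSplitting_push : ∀ i, toBranchSystem.IsSplitting (split i) (push i) 1
  /-- Elements fixing the first `m` roots and collapsing all other roots. -/
  initial : ℕ → M
  exists_initial_zero : ∃ l, initial 0 = root l
  initial_last : initial r = 1
  /-- The first component of a splitting which separates one root. -/
  select : Fin r → M
  isSplitting_initial : ∀ m : Fin r, toBranchSystem.IsSplitting (select m)
    (fun a => if a = base then initial m else root m) (initial (m + 1))

namespace PrefixSystem

open PresentedBy

variable {n k r : ℕ} {M : Type*} [Monoid M]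

/-- The roots are separated one at a time: `z m` distinguishes the first `m` of them, and each step
uses one more `root m`. -/
theorem of_forall_root {N : Type*} [Monoid N] {α : Type*} [MulAction N α] {Q : α → Prop}
    {z : ℕ → N} {root : Fin r → N} (h0 : ∃ l, z 0 = root l) (hz : z r = 1)
    (hQ : ∀ (m : Fin r) y, Q (z m • y) → Q (root m • y) → Q (z (m + 1) • y)) (y : α)
    (h : ∀ l, Q (root l • y)) : Q y := by
  have key : ∀ m ≤ r, Q (z m • y) := by
    intro m
    induction m with
    | zero =>
      obtain ⟨l, hl⟩ := h0
      exact fun _ => hl ▸ h l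
    | succ m ih => exact fun hm => hQ ⟨m, hm⟩ y (ih (by omega)) (h _)
  simpa [hz] using key r le_rfl

/-- Membership in a submonoid closed under splittings can be checked on deep cones, where every
element is a product of letters and a root. -/
theorem fg (P : PrefixSystem n k r M) : Monoid.FG M := by
  obtain ⟨H, hH, hS, hsplit⟩ := P.exists_fg_submonoid
    (S := Set.range (fun p : Fin n × Fin k => P.push p.1 p.2) ∪ Set.range P.root ∪
      Set.range P.split ∪ Set.range P.select)
    ((((Set.finite_range _).union (Set.finite_range _)).union (Set.finite_range _)).union
      (Set.finite_range _))
  simp only [Set.union_subset_iff, Set.range_subset_iff] at hS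
  obtain ⟨⟨⟨hpush, hroot⟩, hsp⟩, hsel⟩ := hS
  refine ⟨?_⟩
  convert hH
  refine (eq_top_iff.mpr fun f _ => ?_).symm
  obtain ⟨K, hK⟩ := IsDeep.of_exact P.push_commute _ (P.exists_depth f).choose_spec
  refine of_forall_long_words (Q := fun f => f ∈ H) P.push_commute P.root_commute
    (fun i y hy => ?_) (of_forall_root P.exists_initial_zero P.initial_last fun m y h h' => ?_)
    (fun _ => K) f fun w l hw => ?_
  · exact hsplit _ (hsp i) _ _ (by simpa using (P.isSplitting_push i).mul P.toBranchSystem y) hy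
  · refine hsplit _ (hsel m) _ _ ((P.isSplitting_initial m).mul P.toBranchSystem y) fun a => ?_
    by_cases ha : a = P.base
    · simpa [ha] using h
    · simpa [ha] using h'
  · obtain ⟨v, l', -, e⟩ := hK 0 w l hw
    simp only [smul_eq_mul, e]
    exact H.mul_mem (pushProd_mem H (fun i a => hpush (i, a)) v) (hroot l')

theorem exists_generators (h : Monoid.FG M) :
    ∃ (m : ℕ) (ρ : FreeMonoid (Fin m) →* M), Function.Surjective ρ := by
  obtain ⟨S, hS, hfin⟩ := (Submonoid.fg_iff _).mp h.fg_top
  have := hfin.to_subtype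
  obtain ⟨m, ⟨e⟩⟩ := Finite.exists_equiv_fin S
  refine ⟨m, FreeMonoid.lift fun t => (e.symm t : M), ?_⟩
  rw [← MonoidHom.mrange_eq_top, FreeMonoid.mrange_lift, ← hS]
  congr 1
  ext s
  simp only [Set.mem_range]
  exact ⟨fun ⟨t, ht⟩ => ht ▸ (e.symm t).2, fun hs => ⟨e ⟨s, hs⟩, by simp⟩⟩

theorem isFinitelyPresented (P : PrefixSystem n k r M) : Monoid.IsFinitelyPresented M := by
  obtain ⟨m, ρ, hρ⟩ := exists_generators P.fg
  obtain ⟨sec, hsec⟩ : ∃ sec : M → FreeMonoid (Fin m), ∀ f, ρ (sec f) = f := hρ.hasRightInverse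
  let W := FreeMonoid (Fin m)
  let x : Fin n → Fin k → W := fun i a => sec (P.push i a)
  have hx : ∀ w, ρ (pushProd x w) = pushProd P.push w := fun w => by
    simp only [map_pushProd, x, hsec]
  choose K v l' hvl using fun t : Fin m => P.exists_depth (ρ (.of t))
  let D (t : Fin m) : Set (Fin n → List (Fin k)) := {w | ∀ i, (w i).length = K t}
  have hD : ∀ t, (D t).Finite := fun t => by
    have := Set.Finite.pi (ι := Fin n) (t := fun _ => {w : List (Fin k) | w.length = K t})
      fun _ => List.finite_length_eq (Fin k) (K t)
    exact this.subset fun w hw i _ => hw i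
  have hDf : ∀ t, Finite (D t) := fun t => (hD t).to_subtype
  let T₁ : Set (W × W) := Set.range fun q : {q : Fin n × Fin n // q.1 ≠ q.2} × Fin k × Fin k =>
    (x q.1.1.1 q.2.1 * x q.1.1.2 q.2.2, x q.1.1.2 q.2.2 * x q.1.1.1 q.2.1)
  let T₂ : Set (W × W) := Set.range fun q : Fin r × Fin n × Fin k =>
    (sec (P.root q.1) * x q.2.1 q.2.2, x q.2.1 q.2.2 * sec (P.root q.1))
  -- The action of each generator on prefixes of its exact depth: finitely many relations, which
  -- make every element of the presented monoid deep.
  let T₃ : Set (W × W) := Set.range fun q : Σ t : Fin m, D t × Fin r =>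
    (pushProd x q.2.1.1 * sec (P.root q.2.2) * .of q.1,
      pushProd x (v q.1 q.2.1.1 q.2.2 q.2.1.2) * sec (P.root (l' q.1 q.2.1.1 q.2.2 q.2.1.2)))
  obtain ⟨R, hR, hTR, hRρ, hsep⟩ := P.exists_presentation_separating hsec
    (Λ := Fin n ⊕ Fin r) (d := Sum.elim P.split P.select)
    (y' := Sum.elim P.push fun m a => if a = P.base then P.initial m else P.root m)
    (y := Sum.elim (fun _ => 1) fun m => P.initial (m + 1))
    (by rintro (i | m); exacts [P.isSplitting_push i, P.isSplitting_initial m])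
    -- `sec` is merely a set-theoretic section, so `sec 1`, which occurs in the splittings of `1`,
    -- has to be trivialised by a relation.
    (T := {(sec 1, 1)} ∪ (T₁ ∪ T₂ ∪ T₃))
    ((Set.finite_singleton _).union
      (((Set.finite_range _).union (Set.finite_range _)).union (Set.finite_range _))) (by
    rintro p (rfl | (⟨⟨⟨q, hq⟩, a, b⟩, rfl⟩ | ⟨⟨l, i, a⟩, rfl⟩) | ⟨⟨t, w, l⟩, rfl⟩)
    · simp [hsec]
    · simpa [x, hsec] using (P.push_commute _ _ hq a b).eq
    · simpa [x, hsec] using (P.root_commute l i a).eq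
    · simpa [hx, hsec] using hvl t w.1 l w.2)
  simp only [Set.union_subset_iff, Set.singleton_subset_iff] at hTR
  obtain ⟨h₀, ⟨h₁, h₂⟩, h₃⟩ := hTR
  have hone : ofWord R (sec 1) = 1 := by simpa using ofWord_eq h₀
  let X : Fin n → Fin k → PresentedBy R := fun i a => ofWord R (x i a)
  let root : Fin r → PresentedBy R := fun l => ofWord R (sec (P.root l))
  have hX : ∀ i j, i ≠ j → ∀ a b, Commute (X i a) (X j b) := fun i j hij a b => by
    have := ofWord_eq (h₁ ⟨(⟨(i, j), hij⟩, a, b), rfl⟩)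
    simp only [map_mul] at this
    exact this
  have hroot : ∀ l i a, Commute (root l) (X i a) := fun l i a => by
    have := ofWord_eq (h₂ ⟨(l, i, a), rfl⟩)
    simp only [map_mul] at this
    exact this
  have hdeep : ∀ g, IsDeep X root g := by
    intro g
    obtain ⟨u, rfl⟩ := ofWord_surjective g
    induction u using FreeMonoid.inductionOn with
    | one => simpa using IsDeep.one X root
    | mul u u' hu hu' => simpa using hu.mul hu'
    | of t =>
      refine IsDeep.of_exact hX (K t) fun w l hw => ⟨v t w l hw, l' t w l hw, ?_⟩
      have := ofWord_eq (h₃ ⟨⟨t, ⟨w, hw⟩, l⟩, rfl⟩)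
      simpa only [map_mul, map_pushProd] using this
  obtain ⟨π, hπ⟩ := exists_lift ρ hRρ
  have hπX : ∀ w l, π (pushProd X w * root l) = pushProd P.push w * P.root l := fun w l => by
    simp [map_pushProd, X, x, root, hπ, hsec]
  have hinj : Function.Injective π := by
    intro g h hgh
    obtain ⟨K₁, hK₁⟩ := hdeep g
    obtain ⟨K₂, hK₂⟩ := hdeep h
    refine of_forall_long_words (α := PresentedBy R × PresentedBy R) (Q := fun p => p.1 = p.2)
      hX hroot (fun i y hy => ?_)
      (of_forall_root (α := PresentedBy R × PresentedBy R) (Q := fun p => p.1 = p.2)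
        (z := fun m => ofWord R (sec (P.initial m))) (root := root) ?_ ?_ fun m y e e' => ?_)
      (fun _ => K₁ + K₂) (g, h) fun w l hw => ?_
    · simpa [hone] using hsep (Sum.inl i) y.1 y.2 hy
    · obtain ⟨l, hl⟩ := P.exists_initial_zero
      exact ⟨l, by simp only [hl, root]⟩
    · simp only [P.initial_last, hone]
    · refine hsep (Sum.inr m) y.1 y.2 fun a => ?_
      by_cases ha : a = P.base
      · simpa [ha] using e
      · simpa [ha] using e'
    -- On a common deep cone both elements become normal forms. Their images in `M` agree, hence so
    -- do the normal forms.
    · obtain ⟨v₁, l₁, -, e₁⟩ := hK₁ K₂ w l hw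
      obtain ⟨v₂, l₂, -, e₂⟩ := hK₂ K₁ w l fun i => by rw [add_comm]; exact hw i
      have : π (pushProd X w * root l * g) = π (pushProd X w * root l * h) := by
        rw [map_mul π _ g, map_mul π _ h, hgh]
      rw [e₁, e₂, hπX, hπX] at this
      obtain ⟨rfl, rfl⟩ := P.pushProd_root_injective this
      exact e₁.trans e₂.symm
  refine ⟨m, R, hR, ⟨MulEquiv.ofBijective π ⟨hinj, fun f => ⟨ofWord R (sec f), ?_⟩⟩⟩⟩
  rw [hπ, hsec]

end PrefixSystem

/-! ### Elements of the monoid given by explicit maps -/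

namespace TotM

open Shrubbery

variable {n k r : ℕ}

@[ext] theorem ext {f g : TotM n k r} (h : ∀ x, f.1 x = g.1 x) : f = g :=
  Subtype.ext (ContinuousMap.ext h)

theorem mul_apply (f g : TotM n k r) (x : RootedCantorSpace n k r) :
    (f * g).1 x = g.1 (f.1 x) := rfl

theorem one_apply (x : RootedCantorSpace n k r) : (1 : TotM n k r).1 x = x := rfl

/-- A self-map of the rooted Cantor space which belongs to the monoid `TotM n k r`. -/
def IsTot (f : RootedCantorSpace n k r → RootedCantorSpace n k r) : Prop :=
  ∃ g : TotM n k r, ⇑g.1 = f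

/-- The element of `TotM n k r` with a given underlying map. -/
noncomputable def ofFun (f : RootedCantorSpace n k r → RootedCantorSpace n k r) (hf : IsTot f) :
    TotM n k r := hf.choose

theorem ofFun_apply {f : RootedCantorSpace n k r → RootedCantorSpace n k r} (hf : IsTot f)
    (x : RootedCantorSpace n k r) : (ofFun f hf).1 x = f x := congrFun hf.choose_spec x

theorem isTot_coe (f : TotM n k r) : IsTot f.1 := ⟨f, rfl⟩

theorem isTot_id : IsTot (id : RootedCantorSpace n k r → RootedCantorSpace n k r) := ⟨1, rfl⟩

theorem IsTot.comp {f g : RootedCantorSpace n k r → RootedCantorSpace n k r} (hg : IsTot g)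
    (hf : IsTot f) : IsTot (g ∘ f) := by
  obtain ⟨f, rfl⟩ := hf
  obtain ⟨g, rfl⟩ := hg
  exact ⟨f * g, rfl⟩

theorem IsTot.exists_deep {f : RootedCantorSpace n k r → RootedCantorSpace n k r} (hf : IsTot f) :
    ∃ N, ∀ w : Shrubbery n k r, (∀ i, N ≤ (w.2 i).length) →
      ∃ v : Shrubbery n k r, ∀ u, f (w.append u) = v.append u := by
  obtain ⟨⟨f, D, h, hf⟩, rfl⟩ := hf
  obtain ⟨N, hN⟩ := hf.exists_deep
  exact ⟨N, fun w hw => (hN 0 w hw).imp fun v hv => hv.1⟩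

theorem continuous_append (v : Shrubbery n k r) : Continuous v.append := by
  refine continuous_const.prodMk (continuous_pi fun i => continuous_pi fun j => ?_)
  simp only [appendWord]
  split_ifs
  · exact continuous_const
  · fun_prop

theorem isLocallyConstant_trunc (K : ℕ) :
    IsLocallyConstant (trunc K : RootedCantorSpace n k r → Shrubbery n k r) := by
  have h : IsLocallyConstant fun x : RootedCantorSpace n k r =>
      (x.1, fun (i : Fin n) (j : Fin K) => x.2 i j) :=
    (IsLocallyConstant.iff_continuous _).mpr (by fun_prop)
  exact h.comp fun p : Fin r × (Fin n → Fin K → Fin k) => (p.1, fun i => List.ofFn (p.2 i))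

theorem isTot_of_exact [NeZero k] {f : RootedCantorSpace n k r → RootedCantorSpace n k r} (K : ℕ)
    (h : ∀ w : Shrubbery n k r, (∀ i, (w.2 i).length = K) →
      ∃ v : Shrubbery n k r, ∀ u, f (w.append u) = v.append u) : IsTot f := by
  have hcont : Continuous f := by
    refine continuous_iff_continuousAt.mpr fun x => ?_
    obtain ⟨v, hv⟩ := h (trunc K x) (length_trunc K x)
    have hg : Continuous fun y : RootedCantorSpace n k r => v.append fun i j => y.2 i (j + K) :=
      (continuous_append v).comp (by fun_prop)
    refine hg.continuousAt.congr ?_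
    filter_upwards [(isLocallyConstant_trunc K).eventually_eq x] with y hy
    -- Points near `x` share its truncation, so there `f` strips `K` letters and prepends the fixed
    -- prefix `v`.
    rw [← hv, ← hy, trunc_append]
  have hleaf : ∀ d : leaves (full n k r K), ∃ v : Shrubbery n k r,
      ∀ u, f (d.1.append u) = v.append u := fun d => h _ fun i => by
    rw [eq_trunc_of_mem_leaves d.2 (fun _ _ => 0), length_trunc]
  choose v hv using hleaf
  exact ⟨⟨⟨f, hcont⟩, _, v, isPseudotree_full n k r K, hv⟩, rfl⟩

/-- Prepend the letter `a` in the coordinate `i`. -/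
def pushFun (i : Fin n) (a : Fin k) (x : RootedCantorSpace n k r) : RootedCantorSpace n k r :=
  (x.1, Function.update x.2 i (appendWord [a] (x.2 i)))

/-- Remove the first letter in the coordinate `i`. -/
def popFun (i : Fin n) (x : RootedCantorSpace n k r) : RootedCantorSpace n k r :=
  (x.1, Function.update x.2 i fun j => x.2 i (j + 1))

/-- Replace the root by `l`. -/
def rootFun (l : Fin r) (x : RootedCantorSpace n k r) : RootedCantorSpace n k r := (l, x.2)

@[simp] theorem popFun_pushFun (i : Fin n) (a : Fin k) (x : RootedCantorSpace n k r) :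
    popFun i (pushFun i a x) = x := by
  simp [popFun, pushFun, appendWord]

@[simp] theorem head_pushFun (i : Fin n) (a : Fin k) (x : RootedCantorSpace n k r) :
    (pushFun i a x).2 i 0 = a := by
  simp [pushFun, appendWord]

theorem pushFun_popFun (i : Fin n) (x : RootedCantorSpace n k r) :
    pushFun i (x.2 i 0) (popFun i x) = x := by
  refine Prod.ext rfl (funext fun j => ?_)
  by_cases hj : j = i
  · subst hj
    funext t
    cases t <;> simp [popFun, pushFun, appendWord]
  · simp [popFun, pushFun, hj]

theorem exists_eq_pushFun (i : Fin n) (x : RootedCantorSpace n k r) :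
    ∃ a y, x = pushFun i a y := ⟨_, _, (pushFun_popFun i x).symm⟩

theorem pushFun_comm {i j : Fin n} (hij : i ≠ j) (a b : Fin k) (x : RootedCantorSpace n k r) :
    pushFun i a (pushFun j b x) = pushFun j b (pushFun i a x) := by
  simp [pushFun, hij, hij.symm, Function.update_comm hij]

theorem appendWord_nil (u : ℕ → Fin k) : appendWord [] u = u := by
  funext j
  simp [appendWord]

theorem append_nil (w : Shrubbery n k r) (hw : ∀ i, (w.2 i).length = 0) (u : CantorSpace n k) :
    w.append u = (w.1, u) := by
  refine Prod.ext rfl (funext fun i => funext fun j => ?_)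
  simp [append, appendWord, hw i]

theorem isTot_pushFun [NeZero k] (i : Fin n) (a : Fin k) :
    IsTot (pushFun i a : RootedCantorSpace n k r → _) := by
  refine isTot_of_exact 0 fun w hw => ⟨(w.1, Function.update (fun _ => []) i [a]), fun u => ?_⟩
  rw [append_nil w hw]
  refine Prod.ext rfl (funext fun j => ?_)
  by_cases hj : j = i
  · subst hj; simp [pushFun, append]
  · simp [pushFun, append, hj, appendWord_nil]

theorem isTot_rootFun [NeZero k] (l : Fin r) : IsTot (rootFun l : RootedCantorSpace n k r → _) := by
  refine isTot_of_exact 0 fun w hw => ⟨(l, w.2), fun u => ?_⟩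
  rw [append_nil w hw, append_nil _ (by exact hw)]
  rfl

theorem isTot_of_comp_pushFun [NeZero k] (i : Fin n)
    {f : RootedCantorSpace n k r → RootedCantorSpace n k r}
    (h : ∀ a, IsTot (f ∘ pushFun i a)) : IsTot f := by
  choose N hN using fun a => (h a).exists_deep
  -- The sum bounds every `N a`; the extra letter pays for the one stripped from coordinate `i`.
  refine isTot_of_exact (∑ a, N a + 1) fun w hw => ?_
  obtain ⟨a, t, ht⟩ := List.exists_cons_of_length_eq_add_one (hw i)
  have hlen : ∀ j, N a ≤ (Function.update w.2 i t j).length := fun j => by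
    have h1 := hw j
    have h2 := hw i
    have h3 := Finset.single_le_sum (f := N) (fun _ _ => Nat.zero_le _) (Finset.mem_univ a)
    by_cases hj : j = i
    · subst hj
      simp only [ht, List.length_cons, Function.update_self] at h2 ⊢
      omega
    · simp only [ne_eq, hj, not_false_eq_true, Function.update_of_ne]
      omega
  obtain ⟨v, hv⟩ := hN a (w.1, Function.update w.2 i t) hlen
  refine ⟨v, fun u => ?_⟩
  rw [← hv u, Function.comp_apply]
  congr 1
  refine Prod.ext rfl (funext fun j => ?_)
  by_cases hj : j = i
  · subst hj
    simp [pushFun, append, ht, ← appendWord_append]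
  · simp [pushFun, append, hj]

theorem isTot_of_comp_rootFun [NeZero k] {f : RootedCantorSpace n k r → RootedCantorSpace n k r}
    (h : ∀ l, IsTot (f ∘ rootFun l)) : IsTot f := by
  choose N hN using fun l => (h l).exists_deep
  refine isTot_of_exact (∑ l, N l) fun w hw => hN w.1 w fun i => ?_
  rw [hw i]
  exact Finset.single_le_sum (f := N) (fun _ _ => Nat.zero_le _) (Finset.mem_univ w.1)

/-- Apply the map `f a` behind the first letter `a` in the coordinate `o`. -/
def glueFun (o : Fin n) (f : Fin k → RootedCantorSpace n k r → RootedCantorSpace n k r)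
    (x : RootedCantorSpace n k r) : RootedCantorSpace n k r :=
  pushFun o (x.2 o 0) (f (x.2 o 0) (popFun o x))

@[simp] theorem glueFun_pushFun (o : Fin n)
    (f : Fin k → RootedCantorSpace n k r → RootedCantorSpace n k r) (a : Fin k)
    (x : RootedCantorSpace n k r) : glueFun o f (pushFun o a x) = pushFun o a (f a x) := by
  simp [glueFun]

theorem isTot_glueFun [NeZero k] (o : Fin n)
    {f : Fin k → RootedCantorSpace n k r → RootedCantorSpace n k r} (hf : ∀ a, IsTot (f a)) :
    IsTot (glueFun o f) :=
  isTot_of_comp_pushFun o fun a => by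
    convert (isTot_pushFun o a).comp (hf a) using 1
    funext x
    simp

theorem isTot_popFun [NeZero k] (i : Fin n) : IsTot (popFun i : RootedCantorSpace n k r → _) :=
  isTot_of_comp_pushFun i fun a => by
    convert isTot_id using 1
    funext x
    simp

/-- Move the first letter of the coordinate `i` to the coordinate `o`, applying `p` to it. -/
def moveFun (o i : Fin n) (p : Fin k → Fin k) (x : RootedCantorSpace n k r) :
    RootedCantorSpace n k r :=
  pushFun o (p (x.2 i 0)) (popFun i x)

@[simp] theorem moveFun_pushFun (o i : Fin n) (p : Fin k → Fin k) (a : Fin k)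
    (x : RootedCantorSpace n k r) : moveFun o i p (pushFun i a x) = pushFun o (p a) x := by
  simp [moveFun]

theorem isTot_moveFun [NeZero k] (o i : Fin n) (p : Fin k → Fin k) :
    IsTot (moveFun o i p : RootedCantorSpace n k r → _) :=
  isTot_of_comp_pushFun i fun a => by
    convert isTot_pushFun o (p a) using 1
    funext x
    simp

/-! ### The bijection conjugating the branch `0` to the branch `00` -/

section Shift

variable {q : ℕ}

/-- The bijection with `0u ↦ 00u`, `10u ↦ 1u`, `1bu ↦ 0bu` for `b ≠ 0`, and `au ↦ au` for
`a ≠ 0, 1`, in the coordinate `o`. -/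
def shiftFun (o : Fin n) (x : RootedCantorSpace n (q + 2) r) : RootedCantorSpace n (q + 2) r :=
  if x.2 o 0 = 0 then pushFun o 0 x
  else if x.2 o 0 = 1 then
    if (popFun o x).2 o 0 = 0 then pushFun o 1 (popFun o (popFun o x))
    else pushFun o 0 (popFun o x)
  else x

/-- The inverse of `shiftFun`. -/
def unshiftFun (o : Fin n) (x : RootedCantorSpace n (q + 2) r) : RootedCantorSpace n (q + 2) r :=
  if x.2 o 0 = 0 then
    if (popFun o x).2 o 0 = 0 then popFun o x else pushFun o 1 (popFun o x)
  else if x.2 o 0 = 1 then pushFun o 1 (pushFun o 0 (popFun o x))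
  else x

variable (o : Fin n) (x : RootedCantorSpace n (q + 2) r)

@[simp] theorem shiftFun_zero : shiftFun o (pushFun o 0 x) = pushFun o 0 (pushFun o 0 x) := by
  simp [shiftFun]

@[simp] theorem shiftFun_one_zero :
    shiftFun o (pushFun o 1 (pushFun o 0 x)) = pushFun o 1 x := by
  simp [shiftFun]

theorem shiftFun_one_of_ne {b : Fin (q + 2)} (hb : b ≠ 0) :
    shiftFun o (pushFun o 1 (pushFun o b x)) = pushFun o 0 (pushFun o b x) := by
  simp [shiftFun, hb]

theorem shiftFun_of_ne {a : Fin (q + 2)} (h0 : a ≠ 0) (h1 : a ≠ 1) :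
    shiftFun o (pushFun o a x) = pushFun o a x := by
  simp [shiftFun, h0, h1]

@[simp] theorem unshiftFun_zero_zero :
    unshiftFun o (pushFun o 0 (pushFun o 0 x)) = pushFun o 0 x := by
  simp [unshiftFun]

theorem unshiftFun_zero_of_ne {b : Fin (q + 2)} (hb : b ≠ 0) :
    unshiftFun o (pushFun o 0 (pushFun o b x)) = pushFun o 1 (pushFun o b x) := by
  simp [unshiftFun, hb]

@[simp] theorem unshiftFun_one :
    unshiftFun o (pushFun o 1 x) = pushFun o 1 (pushFun o 0 x) := by
  simp [unshiftFun]

theorem unshiftFun_of_ne {a : Fin (q + 2)} (h0 : a ≠ 0) (h1 : a ≠ 1) :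
    unshiftFun o (pushFun o a x) = pushFun o a x := by
  simp [unshiftFun, h0, h1]

theorem unshiftFun_shiftFun : unshiftFun o (shiftFun o x) = x := by
  obtain ⟨a, x, rfl⟩ := exists_eq_pushFun o x
  by_cases h0 : a = 0
  · simp [h0]
  by_cases h1 : a = 1
  · obtain ⟨b, x, rfl⟩ := exists_eq_pushFun o x
    by_cases hb : b = 0
    · simp [h1, hb]
    · simp [h1, shiftFun_one_of_ne, unshiftFun_zero_of_ne, hb]
  · simp [shiftFun_of_ne, unshiftFun_of_ne, h0, h1]

theorem shiftFun_unshiftFun : shiftFun o (unshiftFun o x) = x := by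
  obtain ⟨a, x, rfl⟩ := exists_eq_pushFun o x
  by_cases h0 : a = 0
  · obtain ⟨b, x, rfl⟩ := exists_eq_pushFun o x
    by_cases hb : b = 0
    · simp [h0, hb]
    · simp [h0, shiftFun_one_of_ne, unshiftFun_zero_of_ne, hb]
  by_cases h1 : a = 1
  · simp [h1]
  · simp [shiftFun_of_ne, unshiftFun_of_ne, h0, h1]

theorem isTot_shiftFun : IsTot (shiftFun o : RootedCantorSpace n (q + 2) r → _) := by
  refine isTot_of_comp_pushFun o fun a => ?_
  by_cases h0 : a = 0
  · convert (isTot_pushFun o (0 : Fin (q + 2))).comp (isTot_pushFun o (0 : Fin (q + 2))) using 1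
    funext x
    simp [h0]
  by_cases h1 : a = 1
  · refine isTot_of_comp_pushFun o fun b => ?_
    by_cases hb : b = 0
    · convert isTot_pushFun o (1 : Fin (q + 2)) using 1
      funext x
      simp [h1, hb]
    · convert (isTot_pushFun o (0 : Fin (q + 2))).comp (isTot_pushFun o b) using 1
      funext x
      simp [h1, shiftFun_one_of_ne, hb]
  · convert isTot_pushFun o a using 1
    funext x
    simp [shiftFun_of_ne, h0, h1]

theorem isTot_unshiftFun : IsTot (unshiftFun o : RootedCantorSpace n (q + 2) r → _) := by
  refine isTot_of_comp_pushFun o fun a => ?_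
  by_cases h0 : a = 0
  · refine isTot_of_comp_pushFun o fun b => ?_
    by_cases hb : b = 0
    · convert isTot_pushFun o (0 : Fin (q + 2)) using 1
      funext x
      simp [h0, hb]
    · convert (isTot_pushFun o (1 : Fin (q + 2))).comp (isTot_pushFun o b) using 1
      funext x
      simp [h0, unshiftFun_zero_of_ne, hb]
  by_cases h1 : a = 1
  · convert (isTot_pushFun o (1 : Fin (q + 2))).comp (isTot_pushFun o (0 : Fin (q + 2))) using 1
    funext x
    simp [h1]
  · convert isTot_pushFun o a using 1
    funext x
    simp [unshiftFun_of_ne, h0, h1]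

end Shift

/-! ### Letters, roots and uniqueness of normal forms -/

/-- The element of `TotM n k r` which prepends the letter `a` in the coordinate `i`. -/
noncomputable def push [NeZero k] (i : Fin n) (a : Fin k) : TotM n k r :=
  ofFun _ (isTot_pushFun i a)

/-- The element of `TotM n k r` which replaces the root by `l`. -/
noncomputable def root [NeZero k] (l : Fin r) : TotM n k r := ofFun _ (isTot_rootFun l)

@[simp] theorem push_apply [NeZero k] (i : Fin n) (a : Fin k) (x : RootedCantorSpace n k r) :
    (push i a).1 x = pushFun i a x := ofFun_apply _ x

@[simp] theorem root_apply [NeZero k] (l : Fin r) (x : RootedCantorSpace n k r) :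
    (root l).1 x = rootFun l x := ofFun_apply _ x

theorem wordProd_push_apply [NeZero k] (i : Fin n) (w : List (Fin k))
    (x : RootedCantorSpace n k r) :
    (wordProd (push i) w).1 x = (x.1, Function.update x.2 i (appendWord w (x.2 i))) := by
  induction w with
  | nil =>
    refine Prod.ext rfl (funext fun j => ?_)
    by_cases hj : j = i
    · subst hj; simp [wordProd, one_apply, appendWord_nil]
    · simp [wordProd, one_apply, hj]
  | cons a w ih =>
    have : wordProd (push i) (a :: w) = wordProd (push i) w * (push i a : TotM n k r) := by
      simp [wordProd]
    rw [this, mul_apply, ih, push_apply, pushFun, show a :: w = [a] ++ w from rfl, appendWord_append]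
    simp

theorem pushProd_push_apply [NeZero k] (w : Fin n → List (Fin k)) (x : RootedCantorSpace n k r) :
    (pushProd push w).1 x = (x.1, fun i => appendWord (w i) (x.2 i)) := by
  have key : ∀ (l : List (Fin n)), l.Nodup → ∀ x : RootedCantorSpace n k r,
      ((l.map fun i => wordProd (push i) (w i)).prod : TotM n k r).1 x =
        (x.1, fun i => if i ∈ l then appendWord (w i) (x.2 i) else x.2 i) := by
    intro l hl
    induction l with
    | nil => exact fun x => rfl
    | cons i l ih =>
      obtain ⟨hi, hl⟩ := List.nodup_cons.mp hl
      intro x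
      rw [List.map_cons, List.prod_cons, mul_apply, ih hl, wordProd_push_apply]
      refine Prod.ext rfl (funext fun j => ?_)
      by_cases hj : j = i
      · subst hj; simp [hi]
      · simp [hj]
  simpa [pushProd, orderedProd] using key _ (List.nodup_finRange n) x

theorem pushProd_root_apply [NeZero k] (w : Fin n → List (Fin k)) (l : Fin r)
    (x : RootedCantorSpace n k r) :
    (pushProd push w * root l).1 x = Shrubbery.append (l, w) x.2 := by
  rw [mul_apply, pushProd_push_apply, root_apply]
  rfl

/-- If `v` were shorter than `w`, the letter at position `v.length` would be free on one side and
fixed on the other; two distinct letters give a contradiction. -/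
theorem eq_of_forall_appendWord_eq {q : ℕ} {v w : List (Fin (q + 2))}
    (h : ∀ u, appendWord v u = appendWord w u) : v = w := by
  have key : ∀ {v w : List (Fin (q + 2))}, (∀ u, appendWord v u = appendWord w u) →
      ¬ v.length < w.length := by
    intro v w h hlt
    have h0 := congrFun (h fun _ => 0) v.length
    have h1 := congrFun (h fun _ => 1) v.length
    simp only [appendWord, lt_irrefl, dite_false, hlt, dite_true] at h0 h1
    exact zero_ne_one (h0.trans h1.symm)
  have hlen : v.length = w.length :=
    le_antisymm (not_lt.mp (key fun u => (h u).symm)) (not_lt.mp (key h))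
  exact (prefix_of_appendWord_eq (h fun _ => 0) hlen.le).eq_of_length hlen

/-! ### The branch system and prefix system of the monoid -/

section System

variable {q : ℕ}

/-- The branch system on `TotM n (q + 2) r` given by the first letter of the coordinate `o`. -/
noncomputable def branchSystem (o : Fin n) (r q : ℕ) :
    BranchSystem (q + 2) (TotM n (q + 2) r) where
  glue :=
    { toFun := fun f => ofFun _ (isTot_glueFun o fun a => isTot_coe (f a))
      map_one' := by
        ext1 x
        obtain ⟨a, x, rfl⟩ := exists_eq_pushFun o x
        simp [ofFun_apply, one_apply]
      map_mul' := fun f g => by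
        ext1 x
        obtain ⟨a, x, rfl⟩ := exists_eq_pushFun o x
        simp [ofFun_apply, mul_apply] }
  fold := ofFun _ (isTot_popFun o)
  base := 0
  swap a :=
    { val := ofFun _ (isTot_moveFun o o (Equiv.swap 0 a))
      inv := ofFun _ (isTot_moveFun o o (Equiv.swap 0 a))
      val_inv := by
        ext1 x
        obtain ⟨a, x, rfl⟩ := exists_eq_pushFun o x
        simp [ofFun_apply, mul_apply, one_apply]
      inv_val := by
        ext1 x
        obtain ⟨a, x, rfl⟩ := exists_eq_pushFun o x
        simp [ofFun_apply, mul_apply, one_apply] }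
  shift :=
    { val := ofFun _ (isTot_shiftFun o)
      inv := ofFun _ (isTot_unshiftFun o)
      val_inv := by ext1 x; simp [ofFun_apply, mul_apply, one_apply, unshiftFun_shiftFun]
      inv_val := by ext1 x; simp [ofFun_apply, mul_apply, one_apply, shiftFun_unshiftFun] }
  glue_mulSingle a f := by
    rw [mul_assoc, Units.eq_inv_mul_iff_mul_eq]
    ext1 x
    obtain ⟨b, x, rfl⟩ := exists_eq_pushFun o x
    simp only [MonoidHom.coe_mk, OneHom.coe_mk, mul_apply, ofFun_apply, moveFun_pushFun,
      glueFun_pushFun]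
    by_cases hb : b = 0
    · simp [hb]
    · by_cases hba : b = a
      · subst hba
        simp [hb, one_apply]
      · simp [Equiv.swap_apply_of_ne_of_ne hb hba, hb, hba, one_apply]
  -- `shift` maps the cone of `0` onto that of `00` and its complement onto the complement, so it
  -- transports the action behind `0` to the action behind `00`.
  glue_base_base f := by
    rw [mul_assoc, Units.eq_inv_mul_iff_mul_eq]
    ext1 x
    obtain ⟨a, x, rfl⟩ := exists_eq_pushFun o x
    simp only [MonoidHom.coe_mk, OneHom.coe_mk, mul_apply, ofFun_apply, glueFun_pushFun]
    by_cases h0 : a = 0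
    · simp [h0, ofFun_apply]
    by_cases h1 : a = 1
    · obtain ⟨b, x, rfl⟩ := exists_eq_pushFun o x
      by_cases hb : b = 0
      · simp [h1, hb, one_apply]
      · simp [h1, hb, shiftFun_one_of_ne, ofFun_apply, one_apply]
    · simp [shiftFun_of_ne, h0, h1, one_apply]
  glue_const_fold f := by
    ext1 x
    obtain ⟨a, x, rfl⟩ := exists_eq_pushFun o x
    simp [ofFun_apply, mul_apply]

/-- Fix the roots below `m` and replace all others by `0`. -/
def initialFun [NeZero r] (m : ℕ) (x : RootedCantorSpace n k r) : RootedCantorSpace n k r :=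
  (if (x.1 : ℕ) < m then x.1 else 0, x.2)

theorem isTot_initialFun [NeZero k] [NeZero r] (m : ℕ) :
    IsTot (initialFun m : RootedCantorSpace n k r → _) :=
  isTot_of_comp_rootFun fun l => isTot_rootFun (if (l : ℕ) < m then l else 0)

/-- Prepend `1` in the coordinate `o` at the root `m`, and `0` at all other roots. -/
def selectFun (o : Fin n) (m : Fin r) (x : RootedCantorSpace n (q + 2) r) :
    RootedCantorSpace n (q + 2) r :=
  pushFun o (if x.1 = m then 1 else 0) x

theorem isTot_selectFun (o : Fin n) (m : Fin r) :
    IsTot (selectFun o m : RootedCantorSpace n (q + 2) r → _) :=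
  isTot_of_comp_rootFun fun l => (isTot_pushFun o (if l = m then 1 else 0)).comp (isTot_rootFun l)

/-- The prefix system on `TotM n (q + 2) r`. -/
noncomputable def prefixSystem (o : Fin n) (r q : ℕ) [NeZero r] :
    PrefixSystem n (q + 2) r (TotM n (q + 2) r) where
  toBranchSystem := branchSystem o r q
  push := push
  root := root
  push_commute i j hij a b := by
    ext1 x
    simp [mul_apply, pushFun_comm hij]
  root_commute l i a := by
    ext1 x
    simp [mul_apply, pushFun, rootFun]
  pushProd_root_injective := by
    intro v w l l' h
    have key : ∀ u : CantorSpace n (q + 2),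
        Shrubbery.append (l, v) u = Shrubbery.append (l', w) u := fun u => by
      rw [← pushProd_root_apply v l (l, u), ← pushProd_root_apply w l' (l, u), h]
    refine ⟨funext fun i => eq_of_forall_appendWord_eq fun u => ?_,
      (Prod.ext_iff.mp (key fun _ _ => 0)).1⟩
    exact congrFun (Prod.ext_iff.mp (key fun _ => u)).2 i
  exists_depth f := by
    obtain ⟨K, hK⟩ := (isTot_coe f).exists_deep
    refine ⟨K, fun w l hw => ?_⟩
    obtain ⟨v, hv⟩ := hK (l, w) fun i => (hw i).ge
    refine ⟨v.2, v.1, ?_⟩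
    ext1 x
    rw [mul_apply, pushProd_root_apply, pushProd_root_apply, hv]
  split i := ofFun _ (isTot_moveFun o i id)
  -- The first letter of coordinate `i` is moved to `o` as a branch label, restored by `push i a` on
  -- branch `a`, and the label is then dropped.
  isSplitting_push i := by
    ext1 x
    obtain ⟨a, x, rfl⟩ := exists_eq_pushFun i x
    simp [branchSystem, mul_apply, ofFun_apply, one_apply]
  initial m := ofFun _ (isTot_initialFun m)
  exists_initial_zero := ⟨0, by ext1 x; simp [ofFun_apply, initialFun, rootFun]⟩
  initial_last := by ext1 x; simp [ofFun_apply, initialFun, one_apply]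
  select m := ofFun _ (isTot_selectFun o m)
  -- Root `m` is sent to branch `1` and restored there by `root m`; all other roots go to branch
  -- `0`, where `initial m` and `initial (m + 1)` agree.
  isSplitting_initial m := by
    ext1 x
    simp only [branchSystem, MonoidHom.coe_mk, OneHom.coe_mk, mul_apply, ofFun_apply, selectFun,
      glueFun_pushFun, popFun_pushFun]
    by_cases hx : x.1 = m
    · simp [hx, initialFun, rootFun]
    · have : (x.1 : ℕ) ≠ m := fun h => hx (Fin.ext h)
      have h' : (x.1 : ℕ) < m ↔ (x.1 : ℕ) < m + 1 := by omega
      simp [hx, initialFun, ofFun_apply, h']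

end System

end TotM

theorem theorem2 (n k r : ℕ) (hn : 1 ≤ n) (hk : 2 ≤ k) (hr : 1 ≤ r) :
    Monoid.IsFinitelyPresented (TotM n k r) := by
  obtain ⟨q, rfl⟩ := Nat.exists_eq_add_of_le' hk
  have : NeZero r := ⟨by omega⟩
  exact (TotM.prefixSystem ⟨0, hn⟩ r q).isFinitelyPresented
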